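/- Let $d\ge 0$ be an integer. A lattice in $\mathbb R^d$ is a discrete additive subgroup $\Lambda\subset\mathbb R^d$ of rank $d$; its dual is $\Lambda^*=\{c\in\mathbb R^d:\langle c,x\rangle\in\mathbb Z\text{ for all }x\in\Lambda\}$, where $\langle\cdot,\cdot\rangle$ is the standard scalar product. A convex body is a nonempty compact convex set $B\subset\mathbb R^d$ (interior points are not required). Put $$\operatorname{width}(B,c)=\max_{x\in B}\langle c,x\rangle-\min_{x\in B}\langle c,x\rangle,\qquad \operatorname{width}(B)=\inf_{c\in\Lambda^*\setminus\{0\}}\operatorname{width}(B,c).$$ Call a real number $\omega$ a flatness constant in dimension $d$ if for every lattice $\Lambda\subset\mathbb R^d$ and every convex body $B\subset\mathbb R^d$ with $B\cap\Lambda=\emptyset$ one has $\operatorname{width}(B)\le\omega$. **Theorem 4.3 (with Corollary 4.4).** A flatness constant in dimension $d$ exists. Let $\omega(d)$ be any flatness constant in dimension $d$, let $\Lambda\subset\mathbb R^d$ be a lattice, $B\subset\mathbb R^d$ a convex body and $c\in\Lambda^*$ a nonzero vector. Then $Y=\{\langle c,x\rangle: x\in B\cap\Lambda\}$ is a finite set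 of integers. If, moreover, $\operatorname{width}(B,c)\le 2\operatorname{width}(B)$, then: 1. for any $y_1,y_2\in Y$ with $y_2-y_1>2\omega(d)$ there exists $y\in Y$ with $y_1<y<y_2$; 2. if $Y\neq\emptyset$ and $m=\lceil 2\omega(d)\rceil$, then $Y\setminus\bigcup_{l=1}^{m}(Y+l)$ consists of a single point, where $Y+l=\{y+l:y\in Y\}$. -/

import Mathlib

namespace LatticeGaps

/-- The dual (reciprocal) lattice of `Λ`: the vectors whose standard scalar product with every
element of `Λ` is an integer. -/
noncomputable def dualLattice {d : ℕ} (Λ : Submodule ℤ (EuclideanSpace ℝ (Fin d))) :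
    Submodule ℤ (EuclideanSpace ℝ (Fin d)) :=
  LinearMap.BilinForm.dualSubmodule (innerₗ (EuclideanSpace ℝ (Fin d))) Λ

theorem mem_dualLattice {d : ℕ} {Λ : Submodule ℤ (EuclideanSpace ℝ (Fin d))}
    {c : EuclideanSpace ℝ (Fin d)} :
    c ∈ dualLattice Λ ↔ ∀ x ∈ Λ, ∃ n : ℤ, inner ℝ c x = (n : ℝ) := by
  simp only [dualLattice, LinearMap.BilinForm.mem_dualSubmodule, Submodule.mem_one,
    innerₗ_apply_apply]
  constructor
  · intro h x hx
    obtain ⟨n, hn⟩ := h x hx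
    exact ⟨n, by simpa using hn.symm⟩
  · intro h x hx
    obtain ⟨n, hn⟩ := h x hx
    exact ⟨n, by simpa using hn.symm⟩

/-- The width of `B` in the direction `c`. A `ConvexBody` is a nonempty compact convex set (not
necessarily with interior points), so the supremum and the infimum are a maximum and a minimum. -/
noncomputable def widthAlong {d : ℕ} (B : ConvexBody (EuclideanSpace ℝ (Fin d)))
    (c : EuclideanSpace ℝ (Fin d)) : ℝ :=
  sSup ((fun x => inner ℝ c x) '' (B : Set (EuclideanSpace ℝ (Fin d)))) -
    sInf ((fun x => inner ℝ c x) '' (B : Set (EuclideanSpace ℝ (Fin d))))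

/-- The lattice width of `B` with respect to `Λ`, over the nonzero vectors of the dual lattice.
It is a minimum when `B` has interior points; for lower-dimensional `B` the infimum need not be
attained. -/
noncomputable def latticeWidth {d : ℕ} (Λ : Submodule ℤ (EuclideanSpace ℝ (Fin d)))
    (B : ConvexBody (EuclideanSpace ℝ (Fin d))) : ℝ :=
  sInf (widthAlong B '' {c | c ∈ dualLattice Λ ∧ c ≠ 0})

/-- `ω` is a flatness constant in dimension `d`: for every lattice in `ℝ^d`, every convex body
without lattice points has lattice width at most `ω`. -/
def IsFlatnessConstant (d : ℕ) (ω : ℝ) : Prop :=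
  ∀ (Λ : Submodule ℤ (EuclideanSpace ℝ (Fin d))) [DiscreteTopology Λ] [IsZLattice ℝ Λ]
    (B : ConvexBody (EuclideanSpace ℝ (Fin d))),
    (B : Set (EuclideanSpace ℝ (Fin d))) ∩ (Λ : Set (EuclideanSpace ℝ (Fin d))) = ∅ →
    latticeWidth Λ B ≤ ω

/-- The set of the values `⟨c, x⟩` at the lattice points `x` of `B`, as a set of integers. -/
def valueSet {d : ℕ} (Λ : Submodule ℤ (EuclideanSpace ℝ (Fin d)))
    (B : ConvexBody (EuclideanSpace ℝ (Fin d))) (c : EuclideanSpace ℝ (Fin d)) : Set ℤ :=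
  {n | ∃ x ∈ (B : Set (EuclideanSpace ℝ (Fin d))) ∩ (Λ : Set (EuclideanSpace ℝ (Fin d))),
    inner ℝ c x = (n : ℝ)}

end LatticeGaps

/-!
# Gaps between lattice points of a convex body

Flatness is a statement about dual vectors. Let `L` be a lattice all of whose nonzero dual vectors
have norm at least `r`. Then the covering radius of `L` is at most `3 ^ d / r`
(`exists_mem_norm_sub_le`), by induction on the dimension: take an almost shortest dual vector `c`
and slice the lattice by the hyperplanes on which `c` takes integral values. They are at most `1 / r`
apart, and each contains a translate of the lattice `L ∩ c^⊥`. A dual vector of this smaller lattice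
lifts to one of `L` after adding at most half of `c`, so it cannot be much shorter than `c`.

To apply this to a convex body with interior points, inscribe a simplex of maximal volume. In its
coordinates the body contains a cube of side `1 / d` and lies in `[-1, 1] ^ d`
(`exists_simplex_coords_le_one`), so large lattice width makes the dual vectors long, and a lattice
point lies in the cube (`latticeWidth_le_of_interior_nonempty`). Bodies without interior points are
thickened first (`isFlatnessConstant`).

For the gaps, suppose that consecutive values `y₁ < y₂` of `c` at the lattice points of `B` are more
than `2 * ω` apart. Shrink `B` homothetically towards one of its points so that the values of `c` on
the copy fill almost all of `(y₁, y₂)`. The copy has no lattice points, but its width along `c` is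
more than `2 * ω`; since `c` realizes the lattice width up to the factor `2`, the lattice width of
the copy exceeds `ω` (`exists_mem_valueSet_between`). Hence every value except the least one
has a predecessor at distance at most `⌈2 * ω⌉`.
-/

namespace LatticeGaps

open Module

/-! ### Covering radius and the shortest dual vector -/

/-- A lattice in a nonzero space has a nonzero dual vector: the Riesz representative of a
coordinate functional of a lattice basis. -/
theorem exists_dual_ne_zero {E : Type*} [NormedAddCommGroup E] [InnerProductSpace ℝ E]
    [FiniteDimensional ℝ E] [Nontrivial E] (L : Submodule ℤ E) [DiscreteTopology L]
    [IsZLattice ℝ L] : ∃ c : E, c ≠ 0 ∧ ∀ x ∈ L, ∃ n : ℤ, inner ℝ c x = n := by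
  have : Module.Free ℤ L := ZLattice.module_free ℝ L
  set b := Free.chooseBasis ℤ L with hb
  have hι : Nonempty (Free.ChooseBasisIndex ℤ L) := (b.ofZLatticeBasis ℝ L).index_nonempty
  obtain ⟨i⟩ := hι
  have key : ∀ x, inner ℝ ((InnerProductSpace.toDual ℝ E).symm
      (LinearMap.toContinuousLinearMap ((b.ofZLatticeBasis ℝ L).coord i))) x =
      (b.ofZLatticeBasis ℝ L).repr x i := by
    intro x
    rw [InnerProductSpace.toDual_symm_apply]
    rfl
  refine ⟨_, ?_, fun x hx => ⟨b.repr ⟨x, hx⟩ i, (key x).trans ?_⟩⟩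
  · intro h0
    have := key (b.ofZLatticeBasis ℝ L i)
    rw [h0] at this
    simp at this
  · simpa using b.ofZLatticeBasis_repr_apply ℝ L ⟨x, hx⟩ i

/-- If all nonzero dual vectors have norm at least `s`, then a dual vector of norm less than `2 * s`
is primitive: it takes the value `1` on the lattice. -/
theorem exists_inner_eq_one {E : Type*} [NormedAddCommGroup E] [InnerProductSpace ℝ E]
    (L : Submodule ℤ E) (hL : Submodule.span ℝ (L : Set E) = ⊤) {s : ℝ}
    (hs : ∀ c : E, c ≠ 0 → (∀ x ∈ L, ∃ n : ℤ, inner ℝ c x = n) → s ≤ ‖c‖)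
    {c : E} (hc0 : c ≠ 0) (hc : ∀ x ∈ L, ∃ n : ℤ, inner ℝ c x = n) (hcs : ‖c‖ < 2 * s) :
    ∃ y ∈ L, inner ℝ c y = 1 := by
  -- The values of `c` on `L` form a subgroup of `ℤ`, generated by some `m`.
  let H : AddSubgroup ℤ :=
    { carrier := {n | ∃ x ∈ L, inner ℝ c x = n}
      zero_mem' := ⟨0, L.zero_mem, by simp⟩
      add_mem' := by
        rintro a b ⟨x, hx, hxa⟩ ⟨y, hy, hyb⟩
        exact ⟨x + y, L.add_mem hx hy, by rw [inner_add_right, hxa, hyb]; push_cast; rfl⟩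
      neg_mem' := by
        rintro a ⟨x, hx, hxa⟩
        exact ⟨-x, L.neg_mem hx, by rw [inner_neg_right, hxa]; push_cast; rfl⟩ }
  obtain ⟨m, hm⟩ := Int.subgroup_cyclic H
  have hmul : ∀ x ∈ L, ∃ k : ℤ, inner ℝ c x = (k * m : ℤ) := by
    intro x hx
    obtain ⟨n, hn⟩ := hc x hx
    have hnH : n ∈ H := ⟨x, hx, hn⟩
    rw [hm, AddSubgroup.mem_closure_singleton] at hnH
    obtain ⟨k, hk⟩ := hnH
    exact ⟨k, by rw [hn, ← hk, smul_eq_mul]⟩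
  have hmH : m ∈ H := by rw [hm]; exact AddSubgroup.subset_closure rfl
  have hm0 : m ≠ 0 := by
    rintro rfl
    apply hc0
    have hz : (⊤ : Submodule ℝ E) ≤ LinearMap.ker (innerₗ E c) := by
      rw [← hL, Submodule.span_le]
      intro x hx
      obtain ⟨k, hk⟩ := hmul x hx
      simpa using hk
    have := hz (Submodule.mem_top (x := c))
    simpa using this
  have hm0' : (m : ℝ) ≠ 0 := by exact_mod_cast hm0
  have hle := hs ((m : ℝ)⁻¹ • c) (by simp [hc0, hm0]) (by
    intro x hx
    obtain ⟨k, hk⟩ := hmul x hx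
    refine ⟨k, ?_⟩
    rw [real_inner_smul_left, hk]
    push_cast
    field_simp)
  have habs : |m| < 2 := by
    rw [norm_smul, norm_inv, Real.norm_eq_abs, inv_mul_eq_div, le_div_iff₀ (abs_pos.2 hm0')] at hle
    by_contra hcon
    have h2 : (2 : ℝ) ≤ |(m : ℝ)| := by exact_mod_cast not_lt.1 hcon
    have hs0 : 0 < s := by linarith [norm_nonneg c]
    nlinarith
  have hm1 : m = 1 ∨ m = -1 := by
    rw [abs_lt] at habs
    omega
  have h1 : (1 : ℤ) ∈ H := by
    rcases hm1 with rfl | rfl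
    · exact hmH
    · simpa using H.neg_mem hmH
  obtain ⟨y, hy, h⟩ := h1
  exact ⟨y, hy, by simpa using h⟩

/-- A weak transference bound: if all nonzero dual vectors of a lattice of rank `d` have norm at
least `r`, then every point of the space is within `3 ^ d / r` of the lattice. -/
theorem exists_mem_norm_sub_le (d : ℕ) : ∀ {E : Type*} [NormedAddCommGroup E]
    [InnerProductSpace ℝ E] [FiniteDimensional ℝ E] (_ : finrank ℝ E = d) (L : Submodule ℤ E)
    [DiscreteTopology L] [IsZLattice ℝ L] {r : ℝ} (_ : 0 < r)
    (_ : ∀ c : E, c ≠ 0 → (∀ x ∈ L, ∃ n : ℤ, inner ℝ c x = n) → r ≤ ‖c‖) (x : E),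
    ∃ y ∈ L, ‖x - y‖ ≤ 3 ^ d / r := by
  induction d with
  | zero =>
    intro E _ _ _ hd L _ _ r hr _ x
    have : Subsingleton E := finrank_zero_iff.1 hd
    exact ⟨0, L.zero_mem, by rw [Subsingleton.elim (x - 0) 0, norm_zero]; positivity⟩
  | succ d ih =>
    intro E _ _ _ hd L _ _ r hr hrL x
    have : Nontrivial E := finrank_pos_iff (R := ℝ) |>.1 (by omega)
    have hL : Submodule.span ℝ (L : Set E) = ⊤ := IsZLattice.span_top
    -- A dual vector `c` whose norm is within a factor `3 / 2` of the infimum `s`.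
    set N : Set ℝ := norm '' {c : E | c ≠ 0 ∧ ∀ x ∈ L, ∃ n : ℤ, inner ℝ c x = n} with hN
    have hNne : N.Nonempty := by
      obtain ⟨c, h⟩ := exists_dual_ne_zero L
      exact ⟨_, c, h, rfl⟩
    have hNr : ∀ a ∈ N, r ≤ a := by
      rintro _ ⟨c, ⟨h0, h1⟩, rfl⟩
      exact hrL c h0 h1
    set s := sInf N with hs
    have hrs : r ≤ s := le_csInf hNne hNr
    have hs0 : 0 < s := hr.trans_le hrs
    have hsL : ∀ c : E, c ≠ 0 → (∀ x ∈ L, ∃ n : ℤ, inner ℝ c x = n) → s ≤ ‖c‖ :=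
      fun c h0 h1 => csInf_le ⟨r, hNr⟩ ⟨c, ⟨h0, h1⟩, rfl⟩
    obtain ⟨_, ⟨c, ⟨hc0, hc⟩, rfl⟩, hcs⟩ := exists_lt_of_csInf_lt hNne
      (show sInf N < 3 / 2 * s by rw [← hs]; linarith)
    have hsc := hsL c hc0 hc
    have hcpos : 0 < ‖c‖ := norm_pos_iff.2 hc0
    obtain ⟨y₁, hy₁, hcy₁⟩ := exists_inner_eq_one L hL hsL hc0 hc (by linarith)
    -- The layer `L₀` of lattice points orthogonal to `c` is a lattice in `V = c^⊥`.
    set V : Submodule ℝ E := (ℝ ∙ c)ᗮ with hV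
    have hVmem : ∀ z : E, z ∈ V ↔ inner ℝ c z = 0 := fun z =>
      Submodule.mem_orthogonal_singleton_iff_inner_right
    set L₀ : Submodule ℤ V := L.comap (V.subtype.restrictScalars ℤ) with hL₀
    have hL₀mem : ∀ z : V, z ∈ L₀ ↔ (z : E) ∈ L := fun z => Iff.rfl
    have hdisc : DiscreteTopology L₀ :=
      ZLattice.comap_discreteTopology ℝ L (e := V.subtype) continuous_subtype_val
        Subtype.val_injective
    have hproj : ∀ y ∈ L, ∃ (n : ℤ) (z : V), z ∈ L₀ ∧ y = z + n • y₁ ∧ inner ℝ c y = n := by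
      intro y hy
      obtain ⟨n, hn⟩ := hc y hy
      have hz : y - n • y₁ ∈ V := by
        rw [hVmem, inner_sub_right, hn, ← Int.cast_smul_eq_zsmul ℝ, real_inner_smul_right, hcy₁]
        ring
      exact ⟨n, ⟨_, hz⟩, L.sub_mem hy (L.smul_mem n hy₁), by simp, hn⟩
    have hspan : Submodule.span ℝ (L₀ : Set V) = ⊤ := by
      have hall : ∀ z : E, z - (inner ℝ c z : ℝ) • y₁ ∈
          (Submodule.span ℝ (L₀ : Set V)).map V.subtype := by
        intro z
        have hz : z ∈ Submodule.span ℝ (L : Set E) := hL ▸ Submodule.mem_top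
        induction hz using Submodule.span_induction with
        | mem y hy =>
          obtain ⟨n, w, hw, hyw, hn⟩ := hproj y hy
          refine ⟨w, Submodule.subset_span hw, ?_⟩
          rw [hn, Int.cast_smul_eq_zsmul]
          exact eq_sub_of_add_eq hyw.symm
        | zero => simp
        | add a b _ _ ha hb =>
          have := Submodule.add_mem _ ha hb
          rw [inner_add_right, add_smul]
          convert this using 1
          abel
        | smul t a _ ha =>
          have := Submodule.smul_mem _ t ha
          rw [real_inner_smul_right, mul_smul, ← smul_sub]
          exact this
      rw [eq_top_iff]
      intro z _
      obtain ⟨w, hw, hwz⟩ := hall z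
      rw [(hVmem z).1 z.2, zero_smul, sub_zero] at hwz
      rwa [← Subtype.ext hwz]
    have hlat : IsZLattice ℝ L₀ := ⟨hspan⟩
    have hVd : finrank ℝ V = d := by
      have : Fact (finrank ℝ E = d + 1) := ⟨hd⟩
      exact Submodule.finrank_orthogonal_span_singleton hc0
    -- A dual vector of `L₀` lifts to one of `L` by adding `t • c` with `|t| ≤ 1 / 2`, hence has
    -- norm at least `√(1 - (1 / 2) ^ 2 * (3 / 2) ^ 2) * s`.
    have hdual₀ : ∀ c₀ : V, c₀ ≠ 0 → (∀ z ∈ L₀, ∃ n : ℤ, inner ℝ c₀ z = n) → s / 2 ≤ ‖c₀‖ := by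
      intro c₀ hc₀ hd₀
      set t : ℝ := round (inner ℝ (c₀ : E) y₁ : ℝ) - inner ℝ (c₀ : E) y₁ with ht
      have ht2 : |t| ≤ 1 / 2 := by
        rw [ht, abs_sub_comm]
        exact abs_sub_round _
      have horth : inner ℝ (c₀ : E) c = 0 := by
        rw [real_inner_comm]
        exact (hVmem _).1 c₀.2
      have hnorm : ‖(c₀ : E) + t • c‖ ^ 2 = ‖c₀‖ ^ 2 + t ^ 2 * ‖c‖ ^ 2 := by
        rw [norm_add_sq_real, real_inner_smul_right, horth, norm_smul, Real.norm_eq_abs, mul_pow,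
          sq_abs]
        simp
      have hne : (c₀ : E) + t • c ≠ 0 := by
        intro h
        rw [h, norm_zero] at hnorm
        have : 0 < ‖c₀‖ := norm_pos_iff.2 hc₀
        nlinarith [mul_nonneg (sq_nonneg t) (sq_nonneg ‖c‖), pow_pos this 2]
      have hle := hsL _ hne (by
        intro y hy
        obtain ⟨n, z, hz, hyz, hn⟩ := hproj y hy
        obtain ⟨k, hk⟩ := hd₀ z hz
        refine ⟨k + n * round (inner ℝ (c₀ : E) y₁ : ℝ), ?_⟩
        have hk' : inner ℝ (c₀ : E) (z : E) = (k : ℝ) := hk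
        rw [inner_add_left, real_inner_smul_left, hn, hyz, inner_add_right, hk',
          ← Int.cast_smul_eq_zsmul ℝ, real_inner_smul_right, ht]
        push_cast
        ring)
      have h1 : t ^ 2 ≤ 1 / 4 := by
        rw [← sq_abs]
        nlinarith [abs_nonneg t]
      have h2 : ‖c‖ ^ 2 ≤ 9 / 4 * s ^ 2 := by nlinarith
      have h3 : s ^ 2 ≤ ‖(c₀ : E) + t • c‖ ^ 2 := by gcongr
      have h4 : t ^ 2 * ‖c‖ ^ 2 ≤ 1 / 4 * (9 / 4 * s ^ 2) := by gcongr
      refine le_of_sq_le_sq ?_ (norm_nonneg _)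
      nlinarith
    -- Move `x` by a multiple of `y₁` close to `V`, project, and use the bound for `L₀`.
    set k := round (inner ℝ c x : ℝ) with hk
    set z := x - k • y₁ with hz
    have hcz : |(inner ℝ c z : ℝ)| ≤ 1 / 2 := by
      rw [hz, inner_sub_right, ← Int.cast_smul_eq_zsmul ℝ, real_inner_smul_right, hcy₁, mul_one]
      exact abs_sub_round _
    set u : ℝ := inner ℝ c z / ‖c‖ ^ 2 with hu
    have hz₀ : z - u • c ∈ V := by
      rw [hVmem, inner_sub_right, real_inner_smul_right, real_inner_self_eq_norm_sq, hu]
      field_simp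
      ring
    obtain ⟨y₀, hy₀, hy₀le⟩ := ih hVd L₀ (half_pos hs0) hdual₀ ⟨_, hz₀⟩
    have hy₀le' : ‖z - u • c - y₀‖ ≤ 3 ^ d / (s / 2) := hy₀le
    refine ⟨y₀ + k • y₁, L.add_mem hy₀ (L.smul_mem k hy₁), ?_⟩
    have huc : ‖u • c‖ ≤ 1 / (2 * s) := by
      rw [norm_smul, Real.norm_eq_abs, hu, abs_div, abs_pow, abs_norm]
      calc |(inner ℝ c z : ℝ)| / ‖c‖ ^ 2 * ‖c‖ = |(inner ℝ c z : ℝ)| / ‖c‖ := by field_simp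
        _ ≤ (1 / 2) / s := by gcongr
        _ = 1 / (2 * s) := by field_simp
    calc ‖x - (y₀ + k • y₁)‖ = ‖(z - u • c - y₀) + u • c‖ := by
          rw [hz]
          congr 1
          abel
      _ ≤ 3 ^ d / (s / 2) + 1 / (2 * s) := (norm_add_le _ _).trans (add_le_add hy₀le' huc)
      _ = (2 * 3 ^ d + 1 / 2) / s := by field_simp
      _ ≤ 3 ^ (d + 1) / s := by
          have : (1 : ℝ) ≤ 3 ^ d := one_le_pow₀ (by norm_num)
          gcongr
          rw [pow_succ]
          linarith
      _ ≤ 3 ^ (d + 1) / r := by gcongr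

/-! ### Inscribed simplices of maximal volume -/

/-- Cramer's rule for the coordinates with respect to a basis `v`. -/
theorem det_mul_mk_repr {R M ι : Type*} [CommRing R] [AddCommGroup M] [Module R M] [Fintype ι]
    [DecidableEq ι] (e : Basis ι R M) {v : ι → M} (hli : LinearIndependent R v)
    (hsp : ⊤ ≤ Submodule.span R (Set.range v)) (x : M) (i : ι) :
    e.det v * (Basis.mk hli hsp).repr x i = e.det (Function.update v i x) :=
  LinearMap.congr_fun (e.det_smul_mk_coord_eq_det_update hli hsp i) x

/-- A convex body with interior points contains a simplex with vertices `v` and `v + b i` such that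
every point of the body has coordinates in `[-1, 1]` with respect to the origin `v` and the
basis `b`: a simplex of maximal volume has this property, by Cramer's rule. -/
theorem exists_simplex_coords_le_one {d : ℕ} (B : ConvexBody (EuclideanSpace ℝ (Fin d)))
    (hB : (interior (B : Set (EuclideanSpace ℝ (Fin d)))).Nonempty) :
    ∃ v ∈ B, ∃ b : Basis (Fin d) ℝ (EuclideanSpace ℝ (Fin d)),
      (∀ i, v + b i ∈ B) ∧ ∀ x ∈ B, ∀ i, |b.repr (x - v) i| ≤ 1 := by
  obtain ⟨e, he⟩ : ∃ e, e = (EuclideanSpace.basisFun (Fin d) ℝ).toBasis := ⟨_, rfl⟩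
  let F : EuclideanSpace ℝ (Fin d) × (Fin d → EuclideanSpace ℝ (Fin d)) → ℝ :=
    fun p => |e.det (fun i => p.2 i - p.1)|
  have hcont : Continuous F := by
    refine Continuous.abs ?_
    simp only [Basis.det_apply]
    refine Continuous.matrix_det (continuous_matrix fun i j => ?_)
    simp only [he, Basis.toMatrix_apply, OrthonormalBasis.coe_toBasis_repr_apply,
      EuclideanSpace.basisFun_repr]
    fun_prop
  have hcomp : IsCompact ((B : Set (EuclideanSpace ℝ (Fin d))) ×ˢ
      (Set.univ.pi fun _ : Fin d => (B : Set (EuclideanSpace ℝ (Fin d))))) :=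
    B.isCompact.prod (isCompact_univ_pi fun _ => B.isCompact)
  obtain ⟨x₀, hx₀⟩ := hB
  obtain ⟨ε, hε, hball⟩ := Metric.isOpen_iff.1 isOpen_interior x₀ hx₀
  have hsmall : ∀ i, x₀ + (ε / 2) • e i ∈ B := by
    intro i
    refine interior_subset (hball ?_)
    rw [Metric.mem_ball, dist_eq_norm, add_sub_cancel_left, norm_smul]
    simp only [he, OrthonormalBasis.coe_toBasis, OrthonormalBasis.norm_eq_one, mul_one]
    rw [Real.norm_eq_abs, abs_of_pos (half_pos hε)]
    linarith
  obtain ⟨⟨v, w⟩, ⟨hv, hw⟩, hmax⟩ := hcomp.exists_isMaxOn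
    ⟨(x₀, fun i => x₀ + (ε / 2) • e i), interior_subset hx₀, fun i _ => hsmall i⟩
    hcont.continuousOn
  have hmax' : ∀ w' : Fin d → EuclideanSpace ℝ (Fin d), ∀ v' ∈ B, (∀ i, w' i ∈ B) →
      |e.det (fun i => w' i - v')| ≤ |e.det (fun i => w i - v)| :=
    fun w' v' hv' hw' => hmax (show (v', w') ∈ _ from ⟨hv', fun i _ => hw' i⟩)
  have hpos : 0 < |e.det (fun i => w i - v)| := by
    refine lt_of_lt_of_le ?_ (hmax' _ x₀ (interior_subset hx₀) hsmall)
    have hdet : e.det (fun i => x₀ + (ε / 2) • e i - x₀) = (ε / 2) ^ d := by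
      simp only [add_sub_cancel_left]
      have := e.det.toMultilinearMap.map_smul_univ (fun _ => ε / 2) e
      simpa [e.det_self, div_pow] using this
    rw [hdet]
    positivity
  obtain ⟨hli, hsp⟩ := (e.is_basis_iff_det).2 (isUnit_iff_ne_zero.2 (abs_pos.1 hpos))
  refine ⟨v, hv, Basis.mk hli hsp.ge, fun i => ?_, fun x hx i => ?_⟩
  · simpa using hw i (Set.mem_univ i)
  · have hle := hmax' (Function.update w i x) v hv (by
      intro j
      by_cases h : j = i
      · subst h
        simpa using hx
      · simpa [h] using hw j (Set.mem_univ j))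
    have hupd : (fun j => Function.update w i x j - v) =
        Function.update (fun j => w j - v) i (x - v) := by
      ext1 j
      by_cases h : j = i
      · subst h
        simp
      · simp [h]
    rw [hupd, ← det_mul_mk_repr e hli hsp.ge, abs_mul] at hle
    exact le_of_mul_le_mul_left (by linarith) hpos

/-! ### Widths of convex bodies -/

section Width

variable {d : ℕ} (B : ConvexBody (EuclideanSpace ℝ (Fin d))) (c : EuclideanSpace ℝ (Fin d))

theorem exists_widthAlong_eq : ∃ x ∈ B, ∃ y ∈ B, widthAlong B c = inner ℝ c x - inner ℝ c y ∧
    ∀ z ∈ B, inner ℝ c y ≤ (inner ℝ c z : ℝ) ∧ inner ℝ c z ≤ (inner ℝ c x : ℝ) := by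
  have hf : ContinuousOn (fun x => (inner ℝ c x : ℝ)) (B : Set (EuclideanSpace ℝ (Fin d))) := by
    fun_prop
  obtain ⟨x, hx, hxe, hxm⟩ := B.isCompact.exists_sSup_image_eq_and_ge B.nonempty hf
  obtain ⟨y, hy, hye, hym⟩ := B.isCompact.exists_sInf_image_eq_and_le B.nonempty hf
  exact ⟨x, hx, y, hy, by rw [widthAlong, hxe, hye], fun z hz => ⟨hym z hz, hxm z hz⟩⟩

variable {B} in
theorem inner_sub_inner_le_widthAlong {x y : EuclideanSpace ℝ (Fin d)} (hx : x ∈ B) (hy : y ∈ B) :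
    inner ℝ c x - inner ℝ c y ≤ widthAlong B c := by
  obtain ⟨u, -, v, -, h, hm⟩ := exists_widthAlong_eq B c
  rw [h]
  linarith [(hm x hx).2, (hm y hy).1]

theorem widthAlong_nonneg : 0 ≤ widthAlong B c := by
  obtain ⟨x, hx⟩ := B.nonempty
  simpa using inner_sub_inner_le_widthAlong c hx hx

variable {c} in
theorem latticeWidth_le {Λ : Submodule ℤ (EuclideanSpace ℝ (Fin d))} (hc : c ∈ dualLattice Λ)
    (hc0 : c ≠ 0) : latticeWidth Λ B ≤ widthAlong B c := by
  refine csInf_le ⟨0, ?_⟩ ⟨c, ⟨hc, hc0⟩, rfl⟩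
  rintro _ ⟨c, -, rfl⟩
  exact widthAlong_nonneg B c

theorem latticeWidth_nonneg (Λ : Submodule ℤ (EuclideanSpace ℝ (Fin d))) :
    0 ≤ latticeWidth Λ B := by
  refine Real.sInf_nonneg ?_
  rintro _ ⟨c, -, rfl⟩
  exact widthAlong_nonneg B c

/-- If `B'` contains a translate of `a • B`, then its lattice width is at least `a` times that
of `B`. -/
theorem mul_latticeWidth_le (Λ : Submodule ℤ (EuclideanSpace ℝ (Fin d)))
    {B B' : ConvexBody (EuclideanSpace ℝ (Fin d))} {a : ℝ} (ha : 0 ≤ a)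
    {p : EuclideanSpace ℝ (Fin d)} (h : ∀ x ∈ B, a • x + p ∈ B') :
    a * latticeWidth Λ B ≤ latticeWidth Λ B' := by
  by_cases hne : ∃ c, c ∈ dualLattice Λ ∧ c ≠ 0
  · obtain ⟨c, hc⟩ := hne
    refine le_csInf ⟨_, c, hc, rfl⟩ ?_
    rintro _ ⟨c, ⟨hc, hc0⟩, rfl⟩
    obtain ⟨x, hx, y, hy, hxy, -⟩ := exists_widthAlong_eq B c
    calc a * latticeWidth Λ B ≤ a * widthAlong B c :=
          mul_le_mul_of_nonneg_left (latticeWidth_le B hc hc0) ha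
      _ = inner ℝ c (a • x + p) - inner ℝ c (a • y + p) := by
          rw [hxy, inner_add_right, inner_add_right, real_inner_smul_right, real_inner_smul_right]
          ring
      _ ≤ widthAlong B' c := inner_sub_inner_le_widthAlong c (h x hx) (h y hy)
  · have hempty : {c | c ∈ dualLattice Λ ∧ c ≠ 0} = ∅ :=
      Set.eq_empty_of_forall_notMem fun c hc => hne ⟨c, hc⟩
    simp [latticeWidth, hempty]

end Width

/-! ### The flatness theorem -/

/-- The flatness theorem for convex bodies with interior points. In the coordinates of a simplex of
maximal volume the body contains the cube `[0, 1 / d] ^ d` and lies in `[-1, 1] ^ d`; large lattice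
width makes all dual vectors long, and then some lattice point falls into the small cube. -/
theorem latticeWidth_le_of_interior_nonempty {d : ℕ}
    (Λ : Submodule ℤ (EuclideanSpace ℝ (Fin d))) [DiscreteTopology Λ] [IsZLattice ℝ Λ]
    (B : ConvexBody (EuclideanSpace ℝ (Fin d)))
    (hB : (interior (B : Set (EuclideanSpace ℝ (Fin d)))).Nonempty)
    (hΛ : (B : Set (EuclideanSpace ℝ (Fin d))) ∩ (Λ : Set (EuclideanSpace ℝ (Fin d))) = ∅) :
    latticeWidth Λ B ≤ 4 * (d : ℝ) ^ 2 * 3 ^ d := by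
  rcases Nat.eq_zero_or_pos d with rfl | hd
  · obtain ⟨x, hx⟩ := B.nonempty
    have hx0 : x ∈ Λ := by
      rw [Subsingleton.elim x 0]
      exact Λ.zero_mem
    exact absurd ⟨hx, hx0⟩ (Set.eq_empty_iff_forall_notMem.1 hΛ x)
  by_contra! hlt
  have hd0 : (0 : ℝ) < d := by exact_mod_cast hd
  have hd1 : (1 : ℝ) ≤ d := by exact_mod_cast hd
  obtain ⟨v, hv, b, hb, hcoord⟩ := exists_simplex_coords_le_one B hB
  set e : EuclideanSpace ℝ (Fin d) ≃L[ℝ] EuclideanSpace ℝ (Fin d) :=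
    ((WithLp.linearEquiv 2 ℝ (Fin d → ℝ)).trans b.equivFun.symm).toContinuousLinearEquiv with he
  have he_apply : ∀ t, e t = ∑ i, t i • b i := fun t => b.equivFun_symm_apply _
  have he_symm : ∀ x i, e.symm x i = b.repr x i := fun x i => rfl
  set L : Submodule ℤ (EuclideanSpace ℝ (Fin d)) := ZLattice.comap ℝ Λ e.toLinearMap with hL
  have hLmem : ∀ y, y ∈ L ↔ e y ∈ Λ := fun y => Iff.rfl
  have hnorm : ∀ x ∈ B, ‖e.symm (x - v)‖ ≤ d := by
    intro x hx
    rw [EuclideanSpace.norm_eq, Real.sqrt_le_left hd0.le]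
    calc ∑ i, ‖e.symm (x - v) i‖ ^ 2 ≤ ∑ _i : Fin d, (1 : ℝ) := by
          refine Finset.sum_le_sum fun i _ => pow_le_one₀ (norm_nonneg _) ?_
          rw [he_symm]
          exact hcoord x hx i
      _ = d := by simp
      _ ≤ (d : ℝ) ^ 2 := by nlinarith
  -- The dual vectors of `L` are the pullbacks of those of `Λ`, and they are long.
  have hdual : ∀ c : EuclideanSpace ℝ (Fin d), c ≠ 0 → (∀ x ∈ L, ∃ n : ℤ, inner ℝ c x = n) →
      2 * d * 3 ^ d ≤ ‖c‖ := by
    intro c hc0 hc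
    set c' := ContinuousLinearMap.adjoint
      (e.symm : EuclideanSpace ℝ (Fin d) →L[ℝ] EuclideanSpace ℝ (Fin d)) c with hc'
    have hinner : ∀ x, inner ℝ c' x = (inner ℝ c (e.symm x) : ℝ) := fun x =>
      ContinuousLinearMap.adjoint_inner_left _ x c
    have hc'0 : c' ≠ 0 := by
      intro h
      have := hinner (e c)
      rw [h, inner_zero_left, e.symm_apply_apply] at this
      exact hc0 (inner_self_eq_zero.1 this.symm)
    have hc'm : c' ∈ dualLattice Λ := by
      rw [mem_dualLattice]
      intro x hx
      obtain ⟨n, hn⟩ := hc (e.symm x) (by rwa [hLmem, e.apply_symm_apply])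
      exact ⟨n, (hinner x).trans hn⟩
    obtain ⟨x, hx, y, hy, hxy, -⟩ := exists_widthAlong_eq B c'
    have h1 : widthAlong B c' ≤ ‖c‖ * (d + d) := by
      calc widthAlong B c' = inner ℝ c (e.symm (x - v) - e.symm (y - v)) := by
            rw [hxy, hinner, hinner, ← inner_sub_right, ← map_sub, ← map_sub, sub_sub_sub_cancel_right]
        _ ≤ ‖c‖ * ‖e.symm (x - v) - e.symm (y - v)‖ := real_inner_le_norm _ _
        _ ≤ ‖c‖ * (d + d) := by
            gcongr
            exact (norm_sub_le _ _).trans (add_le_add (hnorm x hx) (hnorm y hy))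
    have h2 := hlt.trans_le ((latticeWidth_le B hc'm hc'0).trans h1)
    nlinarith
  -- Aim at the centre of the cube `[0, 1 / d] ^ d`.
  set m : EuclideanSpace ℝ (Fin d) := WithLp.toLp 2 fun _ => 1 / (2 * (d : ℝ)) with hm
  obtain ⟨y, hy, hyle⟩ := exists_mem_norm_sub_le d (by simp) L
    (show (0 : ℝ) < 2 * d * 3 ^ d by positivity) hdual (m + e.symm v)
  set t := y - e.symm v with ht
  have hti : ∀ i, 0 ≤ t i ∧ t i ≤ 1 / d := by
    intro i
    have h1 : |m i - t i| ≤ 1 / (2 * d) := by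
      calc |m i - t i| = ‖(m + e.symm v - y) i‖ := by
            rw [Real.norm_eq_abs, ht]
            simp only [PiLp.sub_apply, PiLp.add_apply]
            congr 1
            ring
        _ ≤ ‖m + e.symm v - y‖ := PiLp.norm_apply_le _ i
        _ ≤ 3 ^ d / (2 * d * 3 ^ d) := hyle
        _ = 1 / (2 * d) := by field_simp
    have h2 : m i = 1 / (2 * (d : ℝ)) := rfl
    have h3 : 1 / (d : ℝ) = 1 / (2 * d) + 1 / (2 * d) := by
      field_simp
      norm_num
    rw [abs_le, h2] at h1
    constructor <;> linarith
  have hyB : e y ∈ B := by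
    have hsum : ∑ i, t i ≤ 1 := by
      calc ∑ i, t i ≤ ∑ _i : Fin d, 1 / (d : ℝ) := Finset.sum_le_sum fun i _ => (hti i).2
        _ = 1 := by
          rw [Finset.sum_const, Finset.card_univ, Fintype.card_fin, nsmul_eq_mul]
          field_simp
    have hey : e y = ∑ o : Option (Fin d), (o.elim (1 - ∑ i, t i) t) •
        (o.elim v fun i => v + b i) := by
      rw [Fintype.sum_option]
      have : e y = v + e t := by rw [ht, map_sub, e.apply_symm_apply]; abel
      rw [this, he_apply]
      simp only [Option.elim, smul_add, Finset.sum_add_distrib, ← Finset.sum_smul, sub_smul,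
        one_smul]
      abel
    rw [hey]
    refine B.convex.sum_mem ?_ ?_ ?_
    · rintro (_ | i) -
      · exact sub_nonneg.2 hsum
      · exact (hti i).1
    · rw [Fintype.sum_option]
      simp
    · rintro (_ | i) -
      · exact hv
      · exact hb i
  exact (Set.eq_empty_iff_forall_notMem.1 hΛ (e y)) ⟨hyB, (hLmem y).1 hy⟩

/-- The flatness theorem. A body without interior points is first thickened a little, which
enlarges its widths and keeps it away from the lattice. -/
theorem isFlatnessConstant (d : ℕ) : IsFlatnessConstant d (4 * (d : ℝ) ^ 2 * 3 ^ d) := by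
  intro Λ _ _ B hΛ
  have hclosed : IsClosed (Λ : Set (EuclideanSpace ℝ (Fin d))) :=
    AddSubgroup.isClosed_of_discrete (H := Λ.toAddSubgroup)
  obtain ⟨δ, hδ, hsub⟩ := B.isCompact.exists_cthickening_subset_open hclosed.isOpen_compl
    (Set.disjoint_left.1 (Set.disjoint_iff_inter_eq_empty.2 hΛ))
  let B' : ConvexBody (EuclideanSpace ℝ (Fin d)) :=
    ⟨Metric.cthickening δ B, B.convex.cthickening δ, B.isCompact.cthickening,
      B.nonempty.mono (Metric.self_subset_cthickening _)⟩
  have hint : (interior (B' : Set (EuclideanSpace ℝ (Fin d)))).Nonempty := by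
    obtain ⟨x, hx⟩ := B.nonempty
    exact ⟨x, interior_maximal (Metric.thickening_subset_cthickening δ _)
      Metric.isOpen_thickening (Metric.self_subset_thickening hδ _ hx)⟩
  have hdisj : (B' : Set (EuclideanSpace ℝ (Fin d))) ∩ (Λ : Set (EuclideanSpace ℝ (Fin d))) = ∅ :=
    Set.disjoint_iff_inter_eq_empty.1 (Set.disjoint_left.2 hsub)
  have hmono := mul_latticeWidth_le Λ (B := B) (B' := B') (p := 0) zero_le_one (by
    intro x hx
    rw [one_smul, add_zero]
    exact Metric.self_subset_cthickening _ hx)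
  rw [one_mul] at hmono
  exact hmono.trans (latticeWidth_le_of_interior_nonempty Λ B' hint hdisj)

/-! ### Gaps between the values at lattice points -/

section Gaps

variable {d : ℕ} {Λ : Submodule ℤ (EuclideanSpace ℝ (Fin d))}
  {B : ConvexBody (EuclideanSpace ℝ (Fin d))} {c : EuclideanSpace ℝ (Fin d)}

theorem image_valueSet (hc : c ∈ dualLattice Λ) :
    (fun n : ℤ => (n : ℝ)) '' valueSet Λ B c = (fun x => inner ℝ c x) ''
      ((B : Set (EuclideanSpace ℝ (Fin d))) ∩ (Λ : Set (EuclideanSpace ℝ (Fin d)))) := by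
  ext a
  constructor
  · rintro ⟨n, ⟨x, hx, hn⟩, rfl⟩
    exact ⟨x, hx, hn⟩
  · rintro ⟨x, hx, rfl⟩
    obtain ⟨n, hn⟩ := mem_dualLattice.1 hc x hx.2
    exact ⟨n, ⟨x, hx, hn⟩, hn.symm⟩

theorem valueSet_finite : (valueSet Λ B c).Finite := by
  obtain ⟨x, -, y, -, -, h⟩ := exists_widthAlong_eq B c
  refine (Set.finite_Icc ⌈(inner ℝ c y : ℝ)⌉ ⌊(inner ℝ c x : ℝ)⌋).subset ?_
  rintro n ⟨z, ⟨hz, -⟩, hn⟩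
  have := h z hz
  rw [hn] at this
  exact ⟨Int.ceil_le.2 this.1, Int.le_floor.2 this.2⟩

/-- Values of `c` that are more than `2 * ω` apart have a value between them. Otherwise, a
homothetic copy of `B` inside `B`, with ratio chosen so that the values of `c` on it fill almost
all of `(y₁, y₂)`, would be free of lattice points although its lattice width exceeds `ω`. -/
theorem exists_mem_valueSet_between {ω : ℝ} (hω : IsFlatnessConstant d ω) [DiscreteTopology Λ]
    [IsZLattice ℝ Λ] (hc : c ∈ dualLattice Λ) (hw : widthAlong B c ≤ 2 * latticeWidth Λ B)
    {y₁ y₂ : ℤ} (h₁ : y₁ ∈ valueSet Λ B c) (h₂ : y₂ ∈ valueSet Λ B c) (hlt : y₁ < y₂)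
    (hgap : 2 * ω < (y₂ : ℝ) - y₁) : ∃ y ∈ valueSet Λ B c, y₁ < y ∧ y < y₂ := by
  by_contra! hnone
  obtain ⟨x₁, ⟨hx₁, -⟩, hcx₁⟩ := h₁
  obtain ⟨x₂, ⟨hx₂, -⟩, hcx₂⟩ := h₂
  have hlt' : (y₁ : ℝ) < y₂ := by exact_mod_cast hlt
  obtain ⟨u, hu, v, hv, huv, hbd⟩ := exists_widthAlong_eq B c
  set α : ℝ := inner ℝ c v with hα
  set β : ℝ := inner ℝ c u with hβ
  have hα₁ : α ≤ y₁ := hcx₁ ▸ (hbd x₁ hx₁).1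
  have hβ₂ : (y₂ : ℝ) ≤ β := hcx₂ ▸ (hbd x₂ hx₂).2
  have hαβ : 0 < β - α := by linarith
  -- The length `g` of the range of values of the copy lies strictly between `2 * ω` and `y₂ - y₁`.
  obtain ⟨g, hg, hgy⟩ := exists_between (max_lt hgap (sub_pos.2 hlt'))
  have hg0 : 0 < g := (le_max_right _ _).trans_lt hg
  have hgω : 2 * ω < g := (le_max_left _ _).trans_lt hg
  set a : ℝ := g / (β - α) with ha
  have ha0 : 0 < a := div_pos hg0 hαβ
  have hag : a * (β - α) = g := div_mul_cancel₀ _ hαβ.ne'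
  have ha1 : a < 1 := (div_lt_one hαβ).2 (by linarith)
  -- The homothety is centred at `p`, whose value is that of the fixed point of the affine map
  -- from `[α, β]` onto the interval of length `g` with the same midpoint as `[y₁, y₂]`.
  set q : ℝ := ((y₁ + y₂ - g) / 2 - a * α) / (1 - a) with hq
  have h1a : 0 < 1 - a := by linarith
  have hqa : (1 - a) * q = (y₁ + y₂ - g) / 2 - a * α := mul_div_cancel₀ _ h1a.ne'
  have hqα : α ≤ q := by
    refine le_of_mul_le_mul_left ?_ h1a
    rw [hqa]
    linarith
  have hqβ : q ≤ β := by
    refine le_of_mul_le_mul_left ?_ h1a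
    rw [hqa]
    linarith
  obtain ⟨p, hp, hcp⟩ : ∃ p ∈ B, inner ℝ c p = q := by
    have hconn := B.convex.isPreconnected.intermediate_value hv hu
      (f := fun x => (inner ℝ c x : ℝ)) (by fun_prop)
    exact hconn ⟨hqα, hqβ⟩
  let B' : ConvexBody (EuclideanSpace ℝ (Fin d)) :=
    ⟨(fun x => a • x + (1 - a) • p) '' B, by
      have := (B.convex.smul a).translate ((1 - a) • p)
      rw [← Set.image_smul, Set.image_image] at this
      simpa only [add_comm] using this,
      B.isCompact.image (by fun_prop), B.nonempty.image _⟩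
  have hB' : (B' : Set (EuclideanSpace ℝ (Fin d))) ∩ (Λ : Set (EuclideanSpace ℝ (Fin d))) = ∅ := by
    rw [Set.eq_empty_iff_forall_notMem]
    rintro _ ⟨⟨x, hx, rfl⟩, hxΛ⟩
    have hxB : a • x + (1 - a) • p ∈ B := B.convex hx hp ha0.le h1a.le (by ring)
    obtain ⟨n, hn⟩ := mem_dualLattice.1 hc _ hxΛ
    have hval : inner ℝ c (a • x + (1 - a) • p) =
        a * (inner ℝ c x - α) + (y₁ + y₂ - g) / 2 := by
      rw [inner_add_right, real_inner_smul_right, real_inner_smul_right, hcp, hqa]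
      ring
    have hlo : 0 ≤ a * (inner ℝ c x - α) := mul_nonneg ha0.le (sub_nonneg.2 (hbd x hx).1)
    have hhi : a * (inner ℝ c x - α) ≤ g := by
      rw [← hag]
      exact mul_le_mul_of_nonneg_left (by linarith [(hbd x hx).2]) ha0.le
    simp only [hval] at hn
    have hn₁ : y₁ < n := by
      have : (y₁ : ℝ) < n := by linarith
      exact_mod_cast this
    have hn₂ : n < y₂ := by
      have : (n : ℝ) < y₂ := by linarith
      exact_mod_cast this
    exact absurd hn₂ (not_lt.2 (hnone n ⟨_, ⟨hxB, hxΛ⟩, hval.trans hn⟩ hn₁))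
  have hle := (mul_latticeWidth_le Λ ha0.le (B := B) (B' := B') fun x hx =>
    Set.mem_image_of_mem _ hx).trans (hω Λ B' hB')
  have : a * (β - α) ≤ a * (2 * latticeWidth Λ B) :=
    mul_le_mul_of_nonneg_left (huv ▸ hw) ha0.le
  linarith

/-- A finite nonempty set of integers in which any two elements more than `m` apart have an
element between them is covered by its translates by `1, …, m`, except for its least element. -/
theorem exists_diff_iUnion_eq_singleton {Y : Set ℤ} (hfin : Y.Finite) (hne : Y.Nonempty) {m : ℤ}
    (hgap : ∀ y₁ ∈ Y, ∀ y₂ ∈ Y, y₁ < y₂ → m < y₂ - y₁ → ∃ y ∈ Y, y₁ < y ∧ y < y₂) :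
    ∃ z : ℤ, Y \ (⋃ l ∈ Set.Icc (1 : ℤ) m, (fun y => y + l) '' Y) = {z} := by
  obtain ⟨z, hz, hmin⟩ := hfin.exists_minimalFor id Y hne
  have hle : ∀ y ∈ Y, z ≤ y := fun y hy => (le_total z y).elim id fun h => hmin hy h
  refine ⟨z, Set.eq_singleton_iff_unique_mem.2 ⟨⟨hz, ?_⟩, ?_⟩⟩
  · simp only [Set.mem_iUnion, not_exists]
    rintro l ⟨hl, -⟩ ⟨y, hy, hyl⟩
    have := hle y hy
    simp only at hyl
    omega
  · rintro y ⟨hy, hnot⟩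
    by_contra hyz
    have hzy : z < y := lt_of_le_of_ne (hle y hy) (Ne.symm hyz)
    -- The predecessor of `y` in `Y` is at distance at most `m`.
    obtain ⟨w, ⟨hw, hwy⟩, hmax⟩ := (hfin.subset (Set.sep_subset Y fun w => w < y)).exists_maximalFor
      id _ ⟨z, hz, hzy⟩
    have hwm : y - w ≤ m := by
      by_contra! hm
      obtain ⟨x, hx, hwx, hxy⟩ := hgap w hw y hy hwy hm
      exact absurd (hmax ⟨hx, hxy⟩ hwx.le) (not_le.2 hwx)
    refine hnot ?_
    simp only [Set.mem_iUnion]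
    exact ⟨y - w, ⟨by omega, hwm⟩, w, hw, by simp⟩

end Gaps

end LatticeGaps

theorem theorem4p3 (d : ℕ) :
    (∃ ω : ℝ, LatticeGaps.IsFlatnessConstant d ω) ∧
    ∀ ω : ℝ, LatticeGaps.IsFlatnessConstant d ω →
    ∀ (Λ : Submodule ℤ (EuclideanSpace ℝ (Fin d))) [DiscreteTopology Λ] [IsZLattice ℝ Λ]
      (B : ConvexBody (EuclideanSpace ℝ (Fin d))) (c : EuclideanSpace ℝ (Fin d)),
      c ∈ LatticeGaps.dualLattice Λ → c ≠ 0 →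
      (fun n : ℤ => (n : ℝ)) '' LatticeGaps.valueSet Λ B c =
        (fun x => inner ℝ c x) ''
          ((B : Set (EuclideanSpace ℝ (Fin d))) ∩ (Λ : Set (EuclideanSpace ℝ (Fin d)))) ∧
      (LatticeGaps.valueSet Λ B c).Finite ∧
      (LatticeGaps.widthAlong B c ≤ 2 * LatticeGaps.latticeWidth Λ B →
        (∀ y₁ ∈ LatticeGaps.valueSet Λ B c, ∀ y₂ ∈ LatticeGaps.valueSet Λ B c,
          2 * ω < (y₂ : ℝ) - (y₁ : ℝ) →
          ∃ y ∈ LatticeGaps.valueSet Λ B c, y₁ < y ∧ y < y₂) ∧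
        ((LatticeGaps.valueSet Λ B c).Nonempty →
          ∃ z : ℤ, LatticeGaps.valueSet Λ B c \
            (⋃ l ∈ Set.Icc (1 : ℤ) ⌈2 * ω⌉, (fun y => y + l) '' LatticeGaps.valueSet Λ B c) =
              {z})) := by
  open LatticeGaps in
  refine ⟨⟨_, isFlatnessConstant d⟩, fun ω hω Λ _ _ B c hc hc0 =>
    ⟨image_valueSet hc, valueSet_finite, fun hw => ?_⟩⟩
  -- A point that is not in the lattice shows that a flatness constant is nonnegative.
  have hω0 : 0 ≤ ω := by
    set x : EuclideanSpace ℝ (Fin d) := (1 / (2 * ‖c‖ ^ 2)) • c with hx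
    have hcx : inner ℝ c x = (1 / 2 : ℝ) := by
      have := norm_pos_iff.2 hc0
      rw [hx, real_inner_smul_right, real_inner_self_eq_norm_sq]
      field_simp
    have hxΛ : x ∉ Λ := by
      intro hmem
      obtain ⟨n, hn⟩ := mem_dualLattice.1 hc x hmem
      have h2 : (2 * n : ℝ) = 1 := by linarith
      have h3 : 2 * n = 1 := by exact_mod_cast h2
      omega
    exact (latticeWidth_nonneg _ Λ).trans (hω Λ
      ⟨{x}, convex_singleton x, isCompact_singleton, Set.singleton_nonempty x⟩
      (Set.singleton_inter_eq_empty.2 hxΛ))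
  refine ⟨fun y₁ h₁ y₂ h₂ hgap => ?_, fun hne => ?_⟩
  · have hlt : y₁ < y₂ := by
      have : (y₁ : ℝ) < y₂ := by linarith
      exact_mod_cast this
    exact exists_mem_valueSet_between hω hc hw h₁ h₂ hlt hgap
  · exact exists_diff_iUnion_eq_singleton valueSet_finite hne fun y₁ h₁ y₂ h₂ hlt hm =>
      exists_mem_valueSet_between hω hc hw h₁ h₂ hlt
        ((Int.le_ceil _).trans_lt (by exact_mod_cast hm))
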